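/- Let $G$ be a finite group and let $T$ be a $G$-Tambara functor (a product-preserving functor from the category of bispans of finite $G$-sets to sets all of whose values $T(X)$ are commutative rings). A Tambara ideal $I$ of $T$ is a collection of ideals $I(G/H)\subseteq T(G/H)$, one for each subgroup $H\le G$, which together are closed under the restriction, transfer, norm and conjugation maps of $T$; Tambara ideals are ordered by levelwise inclusion. The product $IJ$ is the smallest Tambara ideal containing $I(G/H)\cdot J(G/H)$ for every $H\le G$, and $\langle x\rangle$ is the smallest Tambara ideal containing $x$. A Tambara ideal $\mathfrak p\neq T$ is prime if $IJ\subseteq\mathfrak p$ implies $I\subseteq\mathfrak p$ or $J\subseteq\mathfrak p$ for all Tambara ideals $I,J$. Nakaoka's radical $\sqrt I$ of a Tambara ideal $I$ is given at level $G/H$ by $$\sqrt I(G/H)=\{x\in T(G/H) : \langle x\rangle^n\subseteq I \text{ for some } n\in\mathbb N\}.$$ Then, for every Tambara ideal $I$ of $T$ and every subgroup $H\le G$, $\sqrt I(G/H)$ is the radical $\{x\in T(G/H) : x^n\in I(G/H)\text{ for some } n\}$ of the ideal $I(G/H)$ of the ring $T(G/H)$. Moreover, $\sqrt I$ is a Tambara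 ideal and is equal to the intersection of all prime Tambara ideals of $T$ containing $I$ (the intersection of the empty family being $T$). -/

import Mathlib

/-! ### Finite `G`-sets -/

universe u v

/-- A finite `G`-set. -/
structure FinGSet (G : Type u) [Group G] where
  carrier : Type u
  [action : MulAction G carrier]
  [finite : Finite carrier]

namespace FinGSet

variable {G : Type u} [Group G]

instance : CoeSort (FinGSet G) (Type u) := ⟨FinGSet.carrier⟩

instance (X : FinGSet G) : MulAction G X := X.action

instance (X : FinGSet G) : Finite X := X.finite

/-- The empty `G`-set. -/
def empty (G : Type u) [Group G] : FinGSet G :=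
  letI : MulAction G PEmpty.{u + 1} :=
    { smul := fun _ x => x, one_smul := fun _ => rfl, mul_smul := fun _ _ _ => rfl }
  ⟨PEmpty.{u + 1}⟩

/-- The disjoint union of two finite `G`-sets. -/
def sum (X Y : FinGSet G) : FinGSet G := ⟨X ⊕ Y⟩

/-- The orbit `G/H`. -/
def orbit [Finite G] (H : Subgroup G) : FinGSet G := ⟨G ⧸ H⟩

/-- The unique map out of the empty `G`-set. -/
def fromEmpty (X : FinGSet G) : empty G →[G] X where
  toFun := PEmpty.elim
  map_smul' _ x := x.elim

def inl (X Y : FinGSet G) : X →[G] sum X Y where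
  toFun := Sum.inl
  map_smul' _ _ := rfl

def inr (X Y : FinGSet G) : Y →[G] sum X Y where
  toFun := Sum.inr
  map_smul' _ _ := rfl

/-- The map out of a disjoint union given by two maps. -/
def desc {X Y Z : FinGSet G} (f : X →[G] Z) (g : Y →[G] Z) : sum X Y →[G] Z where
  toFun := Sum.elim f g
  map_smul' c x := by
    cases x with
    | inl x => exact f.map_smul c x
    | inr y => exact g.map_smul c y

/-- The fold map `∇ : X ⊔ X → X`. -/
def fold (X : FinGSet G) : sum X X →[G] X := desc (MulActionHom.id G) (MulActionHom.id G)

/-- The disjoint union of two maps. -/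
def sumMap {X Y X' Y' : FinGSet G} (f : X →[G] X') (g : Y →[G] Y') :
    sum X Y →[G] sum X' Y' :=
  desc ((inl X' Y').comp f) ((inr X' Y').comp g)

/-- The canonical quotient `G/H → G/K`, `xH ↦ xK`, for `H ≤ K`. -/
def orbitMap [Finite G] {H K : Subgroup G} (h : H ≤ K) : orbit H →[G] orbit K where
  toFun := Subgroup.quotientMapOfLE h
  map_smul' c x := by
    induction x using QuotientGroup.induction_on
    rfl

/-- The conjugate subgroup `gHg⁻¹`. -/
def conjSubgroup (g : G) (H : Subgroup G) : Subgroup G := H.map (MulAut.conj g).toMonoidHom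

/-- The canonical isomorphism `G/H → G/gHg⁻¹`, `xH ↦ xg⁻¹(gHg⁻¹)`. -/
def orbitConj [Finite G] (g : G) (H : Subgroup G) : orbit H →[G] orbit (conjSubgroup g H) where
  toFun := Quotient.map' (fun x => x * g⁻¹) (fun a b hab => by
    rw [QuotientGroup.leftRel_apply] at hab ⊢
    exact ⟨a⁻¹ * b, hab, by simp [MulAut.conj_apply, mul_assoc]⟩)
  map_smul' c x := by
    induction x using QuotientGroup.induction_on with
    | H x => exact congrArg (Quotient.mk _) (mul_assoc c x g⁻¹)

/-- The commutative square of finite `G`-sets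
```
  W --g'--> X
  |         |
  f'        f
  v         v
  Y --g---> Z
```
is a pullback. -/
structure IsPullback {W X Y Z : FinGSet G} (g' : W →[G] X) (f' : W →[G] Y)
    (f : X →[G] Z) (g : Y →[G] Z) : Prop where
  comm : ∀ w, f (g' w) = g (f' w)
  existsUnique : ∀ x y, f x = g y → ∃! w, g' w = x ∧ f' w = y

/-- The diagram of finite `G`-sets
```
  E -----f'----> P
  | \            |
  ε  π           h
  v   v          v
  X -g-> Y -f--> Z
```
is an exponential diagram: it commutes, its right-hand square is a pullback, and `h : P → Z`
together with `ε` is the dependent product `Π_f g`. That is, the points of `P` over `z : Z`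
correspond, through `ε`, to the sections of `g` over the fibre `f⁻¹(z)`. -/
structure IsExponential {E P X Y Z : FinGSet G} (g : X →[G] Y) (f : Y →[G] Z)
    (ε : E →[G] X) (π : E →[G] Y) (f' : E →[G] P) (h : P →[G] Z) : Prop where
  comm : ∀ e, g (ε e) = π e
  isPullback : IsPullback π f' f h
  existsUnique : ∀ (z : Z) (s : {y : Y // f y = z} → X), (∀ y, g (s y) = y) →
    ∃! p : P, h p = z ∧ ∀ (e : E) (y : {y : Y // f y = z}), f' e = p → π e = y → ε e = s y

end FinGSet

open FinGSet in
/-- A semi-Mackey functor: a covariant functor `tr` and a contravariant functor `res` from finite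
`G`-sets to sets with the same values on objects, satisfying the base change formula for pullback
squares and taking finite disjoint unions to products. -/
structure SemiMackeyFunctor (G : Type u) [Group G] where
  obj : FinGSet G → Type v
  res : ∀ {X Y : FinGSet G}, (X →[G] Y) → obj Y → obj X
  tr : ∀ {X Y : FinGSet G}, (X →[G] Y) → obj X → obj Y
  res_id : ∀ (X : FinGSet G) (a : obj X), res (MulActionHom.id G : X →[G] X) a = a
  res_comp : ∀ {X Y Z : FinGSet G} (f : Y →[G] Z) (g : X →[G] Y) (a : obj Z),
    res (f.comp g) a = res g (res f a)
  tr_id : ∀ (X : FinGSet G) (a : obj X), tr (MulActionHom.id G : X →[G] X) a = a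
  tr_comp : ∀ {X Y Z : FinGSet G} (f : Y →[G] Z) (g : X →[G] Y) (a : obj X),
    tr (f.comp g) a = tr f (tr g a)
  res_tr : ∀ {W X Y Z : FinGSet G} (g' : W →[G] X) (f' : W →[G] Y) (f : X →[G] Z) (g : Y →[G] Z),
    IsPullback g' f' f g → ∀ a : obj Y, res f (tr g a) = tr g' (res f' a)
  existsUnique_empty : ∃! _a : obj (empty G), True
  bijective_sum : ∀ X Y : FinGSet G, Function.Bijective
    (fun a : obj (sum X Y) => ((res (inl X Y) a, res (inr X Y) a) : obj X × obj Y))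

namespace SemiMackeyFunctor

open FinGSet

variable {G : Type u} [Group G] (M : SemiMackeyFunctor.{u, v} G)

/-- The unique point of `M(∅)`. -/
noncomputable def pt : M.obj (empty G) := M.existsUnique_empty.choose

theorem eq_pt (a : M.obj (empty G)) : a = M.pt :=
  M.existsUnique_empty.choose_spec.2 a trivial

/-- The element of `M(X ⊔ Y)` corresponding to a pair of elements of `M(X)` and `M(Y)`. -/
noncomputable def pair {X Y : FinGSet G} (a : M.obj X) (b : M.obj Y) : M.obj (sum X Y) :=
  ((M.bijective_sum X Y).2 (a, b)).choose

theorem res_inl_pair {X Y : FinGSet G} (a : M.obj X) (b : M.obj Y) :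
    M.res (inl X Y) (M.pair a b) = a :=
  congrArg Prod.fst ((M.bijective_sum X Y).2 (a, b)).choose_spec

theorem res_inr_pair {X Y : FinGSet G} (a : M.obj X) (b : M.obj Y) :
    M.res (inr X Y) (M.pair a b) = b :=
  congrArg Prod.snd ((M.bijective_sum X Y).2 (a, b)).choose_spec

theorem sum_ext {X Y : FinGSet G} {a b : M.obj (sum X Y)}
    (h₁ : M.res (inl X Y) a = M.res (inl X Y) b) (h₂ : M.res (inr X Y) a = M.res (inr X Y) b) :
    a = b :=
  (M.bijective_sum X Y).1 (Prod.ext h₁ h₂)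

/-- The operation on `M(X)` induced by the fold map of `X`. -/
noncomputable def op {X : FinGSet G} (a b : M.obj X) : M.obj X := M.tr (fold X) (M.pair a b)

/-- The neutral element of `M(X)`, induced by the map `∅ → X`. -/
noncomputable def unit (X : FinGSet G) : M.obj X := M.tr (fromEmpty X) M.pt

theorem tr_sumMap_pair {X Y X' Y' : FinGSet G} (f : X →[G] X') (g : Y →[G] Y')
    (a : M.obj X) (b : M.obj Y) :
    M.tr (sumMap f g) (M.pair a b) = M.pair (M.tr f a) (M.tr g b) := by
  apply M.sum_ext
  · rw [M.res_inl_pair, M.res_tr f (inl X Y) (inl X' Y') (sumMap f g) ?_ (M.pair a b),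
      M.res_inl_pair]
    refine ⟨fun _ => rfl, ?_⟩
    rintro x (y | y) h
    · exact ⟨y, ⟨(Sum.inl_injective h).symm, rfl⟩, fun w hw => Sum.inl_injective hw.2⟩
    · exact absurd h Sum.inl_ne_inr
  · rw [M.res_inr_pair, M.res_tr g (inr X Y) (inr X' Y') (sumMap f g) ?_ (M.pair a b),
      M.res_inr_pair]
    refine ⟨fun _ => rfl, ?_⟩
    rintro x (y | y) h
    · exact absurd h Sum.inr_ne_inl
    · exact ⟨y, ⟨(Sum.inr_injective h).symm, rfl⟩, fun w hw => Sum.inr_injective hw.2⟩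

theorem tr_desc_pair {X Y Z : FinGSet G} (f : X →[G] Z) (g : Y →[G] Z)
    (a : M.obj X) (b : M.obj Y) :
    M.tr (desc f g) (M.pair a b) = M.op (M.tr f a) (M.tr g b) := by
  have h : desc f g = (fold Z).comp (sumMap f g) := by
    ext x; cases x <;> rfl
  rw [h, M.tr_comp, M.tr_sumMap_pair]
  rfl

theorem tr_eq_res {X Y : FinGSet G} (e : X →[G] Y) (e' : Y →[G] X)
    (h₁ : ∀ x, e' (e x) = x) (h₂ : ∀ y, e (e' y) = y) (a : M.obj X) : M.tr e a = M.res e' a := by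
  have h := M.res_tr (MulActionHom.id G) e' (MulActionHom.id G) e
    ⟨fun w => (h₂ w).symm, fun x y h => ⟨x, ⟨rfl, (congrArg e' h).trans (h₁ y)⟩,
      fun w hw => hw.1⟩⟩ a
  rwa [M.res_id, M.tr_id] at h

theorem op_comm {X : FinGSet G} (a b : M.obj X) : M.op a b = M.op b a := by
  have h := M.tr_eq_res (desc (inr X X) (inl X X)) (desc (inr X X) (inl X X))
    (by rintro (x | x) <;> rfl) (by rintro (x | x) <;> rfl) (M.pair b a)
  have h' : M.tr (desc (inr X X) (inl X X)) (M.pair b a) = M.pair a b := by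
    rw [h]
    apply M.sum_ext
    · rw [← M.res_comp, M.res_inl_pair]
      exact M.res_inr_pair b a
    · rw [← M.res_comp, M.res_inr_pair]
      exact M.res_inl_pair b a
  have hc : fold X = (fold X).comp (desc (inr X X) (inl X X)) := by
    ext x; cases x <;> rfl
  unfold op
  rw [← h', ← M.tr_comp, ← hc]

theorem op_assoc {X : FinGSet G} (a b c : M.obj X) :
    M.op (M.op a b) c = M.op a (M.op b c) := by
  let α : sum (sum X X) X →[G] sum X (sum X X) :=
    desc (sumMap (MulActionHom.id G) (inl X X)) ((inr X (sum X X)).comp (inr X X))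
  let β : sum X (sum X X) →[G] sum (sum X X) X :=
    desc ((inl (sum X X) X).comp (inl X X)) (sumMap (inr X X) (MulActionHom.id G))
  have h := M.tr_eq_res α β (by rintro ((x | x) | x) <;> rfl) (by rintro (x | (x | x)) <;> rfl)
    (M.pair (M.pair a b) c)
  have h' : M.tr α (M.pair (M.pair a b) c) = M.pair a (M.pair b c) := by
    rw [h]
    apply M.sum_ext
    · rw [← M.res_comp, M.res_inl_pair]
      change M.res ((inl (sum X X) X).comp (inl X X)) _ = _
      rw [M.res_comp, M.res_inl_pair, M.res_inl_pair]
    · rw [← M.res_comp, M.res_inr_pair]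
      apply M.sum_ext
      · rw [← M.res_comp, M.res_inl_pair]
        change M.res ((inl (sum X X) X).comp (inr X X)) _ = _
        rw [M.res_comp, M.res_inl_pair, M.res_inr_pair]
      · rw [← M.res_comp, M.res_inr_pair]
        exact M.res_inr_pair _ _
  have h₁ := M.tr_desc_pair (fold X) (MulActionHom.id G) (M.pair a b) c
  have h₂ := M.tr_desc_pair (MulActionHom.id G) (fold X) a (M.pair b c)
  rw [M.tr_id] at h₁ h₂
  have hc : desc (fold X) (MulActionHom.id G) =
      (desc (MulActionHom.id G) (fold X)).comp α := by
    ext x; rcases x with (x | x) | x <;> rfl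
  rw [hc, M.tr_comp, h'] at h₁
  exact h₁.symm.trans h₂

theorem unit_op {X : FinGSet G} (a : M.obj X) : M.op (M.unit X) a = a := by
  have h := M.tr_desc_pair (fromEmpty X) (MulActionHom.id G) M.pt a
  rw [M.tr_id] at h
  refine h.symm.trans ?_
  rw [M.tr_eq_res _ (inr (empty G) X) ?_ (fun _ => rfl), M.res_inr_pair]
  rintro (x | x)
  · exact x.elim
  · rfl

theorem op_unit {X : FinGSet G} (a : M.obj X) : M.op a (M.unit X) = a := by
  rw [op_comm, unit_op]

theorem res_op {X Y : FinGSet G} (f : X →[G] Y) (a b : M.obj Y) :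
    M.res f (M.op a b) = M.op (M.res f a) (M.res f b) := by
  have h := M.res_tr (fold X) (sumMap f f) f (fold Y) (by
    refine ⟨by rintro (x | x) <;> rfl, ?_⟩
    rintro x (y | y) h
    · refine ⟨Sum.inl x, ⟨rfl, congrArg Sum.inl h⟩, ?_⟩
      rintro (w | w) ⟨h₁, h₂⟩
      · exact congrArg Sum.inl h₁
      · exact absurd h₂ Sum.inr_ne_inl
    · refine ⟨Sum.inr x, ⟨rfl, congrArg Sum.inr h⟩, ?_⟩
      rintro (w | w) ⟨h₁, h₂⟩
      · exact absurd h₂ Sum.inl_ne_inr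
      · exact congrArg Sum.inr h₁) (M.pair a b)
  have h' : M.res (sumMap f f) (M.pair a b) = M.pair (M.res f a) (M.res f b) := by
    apply M.sum_ext
    · rw [← M.res_comp, M.res_inl_pair]
      change M.res ((inl Y Y).comp f) _ = _
      rw [M.res_comp, M.res_inl_pair]
    · rw [← M.res_comp, M.res_inr_pair]
      change M.res ((inr Y Y).comp f) _ = _
      rw [M.res_comp, M.res_inr_pair]
  rw [h'] at h
  exact h

end SemiMackeyFunctor

open FinGSet in
/-- A `G`-semi-Tambara functor, i.e. a product-preserving functor to sets from the category of
bispans of finite `G`-sets, given by the values `tr f`, `nm f`, `res f` on the generating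
morphisms `T_f`, `N_f`, `R_f`. The fields are the defining relations between these generators
(functoriality, base change for `T` and for `N` along `R`, and the exponential relation between
`N` and `T`), and the preservation of finite products. -/
structure SemiTambaraFunctor (G : Type u) [Group G] extends SemiMackeyFunctor.{u, v} G where
  nm : ∀ {X Y : FinGSet G}, (X →[G] Y) → obj X → obj Y
  nm_id : ∀ (X : FinGSet G) (a : obj X), nm (MulActionHom.id G : X →[G] X) a = a
  nm_comp : ∀ {X Y Z : FinGSet G} (f : Y →[G] Z) (g : X →[G] Y) (a : obj X),
    nm (f.comp g) a = nm f (nm g a)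
  res_nm : ∀ {W X Y Z : FinGSet G} (g' : W →[G] X) (f' : W →[G] Y) (f : X →[G] Z) (g : Y →[G] Z),
    IsPullback g' f' f g → ∀ a : obj Y, res f (nm g a) = nm g' (res f' a)
  nm_tr : ∀ {E P X Y Z : FinGSet G} (g : X →[G] Y) (f : Y →[G] Z)
    (ε : E →[G] X) (π : E →[G] Y) (f' : E →[G] P) (h : P →[G] Z),
    IsExponential g f ε π f' h → ∀ a : obj X, nm f (tr g a) = tr h (nm f' (res ε a))

namespace SemiTambaraFunctor

open FinGSet

variable {G : Type u} [Group G] (S : SemiTambaraFunctor.{u, v} G)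

/-- The semi-Mackey functor formed by restrictions and norms. -/
def multiplicative : SemiMackeyFunctor.{u, v} G where
  obj := S.obj
  res := S.res
  tr := S.nm
  res_id := S.res_id
  res_comp := S.res_comp
  tr_id := S.nm_id
  tr_comp := S.nm_comp
  res_tr := S.res_nm
  existsUnique_empty := S.existsUnique_empty
  bijective_sum := S.bijective_sum

/-- Addition is the transfer along the fold map. -/
noncomputable instance (X : FinGSet G) : Add (S.obj X) := ⟨S.toSemiMackeyFunctor.op⟩

/-- Zero is the transfer along `∅ → X`. -/
noncomputable instance (X : FinGSet G) : Zero (S.obj X) := ⟨S.toSemiMackeyFunctor.unit X⟩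

/-- Multiplication is the norm along the fold map. -/
noncomputable instance (X : FinGSet G) : Mul (S.obj X) := ⟨S.multiplicative.op⟩

/-- One is the norm along `∅ → X`. -/
noncomputable instance (X : FinGSet G) : One (S.obj X) := ⟨S.multiplicative.unit X⟩

theorem add_def {X : FinGSet G} (a b : S.obj X) : a + b = S.tr (fold X) (S.pair a b) := rfl

theorem mul_def {X : FinGSet G} (a b : S.obj X) : a * b = S.nm (fold X) (S.pair a b) := rfl

theorem mul_add_aux {X : FinGSet G} (a b c : S.obj X) : a * (b + c) = a * b + a * c := by
  have h₁ : S.pair a (b + c) =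
      S.tr (sumMap (MulActionHom.id G) (fold X)) (S.pair a (S.pair b c)) := by
    rw [S.tr_sumMap_pair, S.tr_id]
    rfl
  have hE : IsExponential (sumMap (MulActionHom.id G : X →[G] X) (fold X)) (fold X)
      (sumMap (fold X) (MulActionHom.id G)) (sumMap (fold X) (fold X))
      (fold (sum X X)) (fold X) := by
    refine ⟨by rintro ((x | x) | (x | x)) <;> rfl,
      ⟨by rintro ((x | x) | (x | x)) <;> rfl, ?_⟩, ?_⟩
    · rintro (x | x) (y | y) h <;> obtain rfl : x = y := h
      · refine ⟨Sum.inl (Sum.inl x), ⟨rfl, rfl⟩, ?_⟩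
        rintro ((w | w) | (w | w)) ⟨h₁, h₂⟩ <;> cases h₁ <;> cases h₂ <;> rfl
      · refine ⟨Sum.inl (Sum.inr x), ⟨rfl, rfl⟩, ?_⟩
        rintro ((w | w) | (w | w)) ⟨h₁, h₂⟩ <;> cases h₁ <;> cases h₂ <;> rfl
      · refine ⟨Sum.inr (Sum.inl x), ⟨rfl, rfl⟩, ?_⟩
        rintro ((w | w) | (w | w)) ⟨h₁, h₂⟩ <;> cases h₁ <;> cases h₂ <;> rfl
      · refine ⟨Sum.inr (Sum.inr x), ⟨rfl, rfl⟩, ?_⟩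
        rintro ((w | w) | (w | w)) ⟨h₁, h₂⟩ <;> cases h₁ <;> cases h₂ <;> rfl
    · intro z s hs
      have hl : s ⟨Sum.inl z, rfl⟩ = Sum.inl z := by
        have h := hs ⟨Sum.inl z, rfl⟩
        rcases hx : s ⟨Sum.inl z, rfl⟩ with x | (x | x) <;> rw [hx] at h
        · exact congrArg Sum.inl (Sum.inl_injective h)
        · exact absurd h Sum.inr_ne_inl
        · exact absurd h Sum.inr_ne_inl
      have hr : s ⟨Sum.inr z, rfl⟩ = Sum.inr (Sum.inl z) ∨
          s ⟨Sum.inr z, rfl⟩ = Sum.inr (Sum.inr z) := by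
        have h := hs ⟨Sum.inr z, rfl⟩
        rcases hx : s ⟨Sum.inr z, rfl⟩ with x | (x | x) <;> rw [hx] at h
        · exact absurd h Sum.inl_ne_inr
        · exact Or.inl (congrArg (fun t => Sum.inr (Sum.inl t)) (Sum.inr_injective h))
        · exact Or.inr (congrArg (fun t => Sum.inr (Sum.inr t)) (Sum.inr_injective h))
      rcases hr with hr | hr
      · refine ⟨Sum.inl z, ⟨rfl, ?_⟩, ?_⟩
        · rintro ((w | w) | (w | w)) ⟨y | y, hy⟩ h₁ h₂ <;> cases hy <;> cases h₁ <;> cases h₂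
          · exact hl.symm
          · exact hr.symm
        · rintro (w | w) ⟨h₁, h₂⟩
          · exact congrArg Sum.inl h₁
          · obtain rfl : w = z := h₁
            have h := h₂ (Sum.inr (Sum.inr w)) ⟨Sum.inr w, rfl⟩ rfl rfl
            rw [hr] at h
            exact absurd (Sum.inr_injective h) Sum.inr_ne_inl
      · refine ⟨Sum.inr z, ⟨rfl, ?_⟩, ?_⟩
        · rintro ((w | w) | (w | w)) ⟨y | y, hy⟩ h₁ h₂ <;> cases hy <;> cases h₁ <;> cases h₂
          · exact hl.symm
          · exact hr.symm
        · rintro (w | w) ⟨h₁, h₂⟩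
          · obtain rfl : w = z := h₁
            have h := h₂ (Sum.inr (Sum.inl w)) ⟨Sum.inr w, rfl⟩ rfl rfl
            rw [hr] at h
            exact absurd (Sum.inr_injective h) Sum.inl_ne_inr
          · exact congrArg Sum.inr h₁
  have h₂ : S.res (sumMap (fold X) (MulActionHom.id G)) (S.pair a (S.pair b c)) =
      S.pair (S.res (fold X) a) (S.pair b c) := by
    apply S.sum_ext
    · rw [← S.res_comp, S.res_inl_pair]
      change S.res ((inl X (sum X X)).comp (fold X)) _ = _
      rw [S.res_comp, S.res_inl_pair]
    · rw [← S.res_comp, S.res_inr_pair]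
      exact S.res_inr_pair _ _
  have h₃ : S.res (fold X) a * S.pair b c = S.pair (a * b) (a * c) := by
    apply S.sum_ext
    · rw [S.res_inl_pair]
      refine (S.multiplicative.res_op (inl X X) _ _).trans ?_
      change S.res (inl X X) (S.res (fold X) a) * S.res (inl X X) (S.pair b c) = a * b
      rw [S.res_inl_pair, ← S.res_comp]
      exact congrArg (· * b) (S.res_id X a)
    · rw [S.res_inr_pair]
      refine (S.multiplicative.res_op (inr X X) _ _).trans ?_
      change S.res (inr X X) (S.res (fold X) a) * S.res (inr X X) (S.pair b c) = a * c
      rw [S.res_inr_pair, ← S.res_comp]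
      exact congrArg (· * c) (S.res_id X a)
  rw [S.mul_def a (b + c), h₁, S.nm_tr _ _ _ _ _ _ hE, h₂, ← S.mul_def, h₃, ← S.add_def]

theorem mul_zero_aux {X : FinGSet G} (a : S.obj X) : a * 0 = 0 := by
  have h₁ : S.pair a (0 : S.obj X) =
      S.tr (sumMap (MulActionHom.id G) (fromEmpty X)) (S.pair a S.pt) := by
    rw [S.tr_sumMap_pair, S.tr_id]
    rfl
  have hE : IsExponential (sumMap (MulActionHom.id G : X →[G] X) (fromEmpty X)) (fold X)
      (fromEmpty _) (fromEmpty _) (MulActionHom.id G) (fromEmpty X) := by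
    refine ⟨fun e => e.elim, ⟨fun e => e.elim, fun _ y => y.elim⟩, fun z s hs => ?_⟩
    have h := hs ⟨Sum.inr z, rfl⟩
    rcases hx : s ⟨Sum.inr z, rfl⟩ with x | x
    · rw [hx] at h
      exact absurd h Sum.inl_ne_inr
    · exact x.elim
  rw [S.mul_def, h₁, S.nm_tr _ _ _ _ _ _ hE, S.eq_pt (S.nm _ _)]
  rfl

/-- The commutative semiring structure on each `S(X)`. -/
noncomputable instance (X : FinGSet G) : CommSemiring (S.obj X) where
  add_assoc := S.toSemiMackeyFunctor.op_assoc
  zero_add := S.toSemiMackeyFunctor.unit_op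
  add_zero := S.toSemiMackeyFunctor.op_unit
  add_comm := S.toSemiMackeyFunctor.op_comm
  nsmul := nsmulRec
  left_distrib := S.mul_add_aux
  right_distrib a b c := by
    have h (x y : S.obj X) : x * y = y * x := S.multiplicative.op_comm x y
    rw [h, S.mul_add_aux, h c a, h c b]
  zero_mul a := (S.multiplicative.op_comm (0 : S.obj X) a).trans (S.mul_zero_aux a)
  mul_zero := S.mul_zero_aux
  mul_assoc := S.multiplicative.op_assoc
  one_mul := S.multiplicative.unit_op
  mul_one := S.multiplicative.op_unit
  mul_comm := S.multiplicative.op_comm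

/-- Every semiring `S(X)` is a ring. -/
def HasNegatives : Prop := ∀ (X : FinGSet G) (a : S.obj X), ∃ b : S.obj X, b + a = 0

end SemiTambaraFunctor

/-- A `G`-Tambara functor: a semi-Tambara functor all of whose values are rings. -/
structure TambaraFunctor (G : Type u) [Group G] extends SemiTambaraFunctor.{u, v} G where
  exists_neg : toSemiTambaraFunctor.HasNegatives

namespace TambaraFunctor

open FinGSet

variable {G : Type u} [Group G]

noncomputable instance (T : TambaraFunctor.{u, v} G) (X : FinGSet G) : CommRing (T.obj X) where
  __ := (inferInstance : CommSemiring (T.obj X))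
  neg a := (T.exists_neg X a).choose
  zsmul := letI : Neg (T.obj X) := ⟨fun a => (T.exists_neg X a).choose⟩; zsmulRec
  neg_add_cancel a := (T.exists_neg X a).choose_spec

variable [Finite G]

/-- The ring `T(G/H)`. -/
abbrev level (T : TambaraFunctor.{u, v} G) (H : Subgroup G) : Type v := T.obj (orbit H)

/-- A Tambara ideal: ideals `I(G/H) ⊆ T(G/H)` closed under restrictions, transfers, norms and
conjugations. -/
@[ext]
structure TambaraIdeal (T : TambaraFunctor.{u, v} G) where
  level : ∀ H : Subgroup G, Ideal (T.level H)
  res_mem : ∀ {H K : Subgroup G} (h : H ≤ K) {a : T.level K},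
    a ∈ level K → T.res (orbitMap h) a ∈ level H
  tr_mem : ∀ {H K : Subgroup G} (h : H ≤ K) {a : T.level H},
    a ∈ level H → T.tr (orbitMap h) a ∈ level K
  nm_mem : ∀ {H K : Subgroup G} (h : H ≤ K) {a : T.level H},
    a ∈ level H → T.nm (orbitMap h) a ∈ level K
  conj_mem : ∀ (g : G) {H : Subgroup G} {a : T.level H},
    a ∈ level H → T.tr (orbitConj g H) a ∈ level (conjSubgroup g H)

namespace TambaraIdeal

variable {T : TambaraFunctor.{u, v} G}

/-- Tambara ideals are ordered by levelwise inclusion. -/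
noncomputable instance : PartialOrder T.TambaraIdeal :=
  PartialOrder.lift TambaraIdeal.level fun _ _ h => TambaraIdeal.ext h

/-- The unit ideal, i.e. `T` itself. -/
noncomputable instance : Top T.TambaraIdeal where
  top :=
    { level := fun _ => ⊤
      res_mem := fun _ _ _ => trivial
      tr_mem := fun _ _ _ => trivial
      nm_mem := fun _ _ _ => trivial
      conj_mem := fun _ _ _ _ => trivial }

/-- The intersection of a set of Tambara ideals, computed levelwise; the intersection of the
empty set is the unit ideal. -/
noncomputable instance : InfSet T.TambaraIdeal where
  sInf A :=
    { level := fun H => ⨅ I ∈ A, I.level H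
      res_mem := fun h a ha => by
        simp only [Submodule.mem_iInf] at ha ⊢
        exact fun I hI => I.res_mem h (ha I hI)
      tr_mem := fun h a ha => by
        simp only [Submodule.mem_iInf] at ha ⊢
        exact fun I hI => I.tr_mem h (ha I hI)
      nm_mem := fun h a ha => by
        simp only [Submodule.mem_iInf] at ha ⊢
        exact fun I hI => I.nm_mem h (ha I hI)
      conj_mem := fun g H a ha => by
        simp only [Submodule.mem_iInf] at ha ⊢
        exact fun I hI => I.conj_mem g (ha I hI) }

/-- `IJ` is the smallest Tambara ideal containing every `I(G/H) J(G/H)`. -/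
noncomputable instance : Mul T.TambaraIdeal where
  mul I J := sInf {K | ∀ H, I.level H * J.level H ≤ K.level H}

/-- The powers `I⁰ = T`, `Iⁿ⁺¹ = Iⁿ I` of a Tambara ideal. -/
noncomputable instance : Pow T.TambaraIdeal ℕ where
  pow I n := Nat.rec ⊤ (fun _ J => J * I) n

/-- `⟨x⟩`, the smallest Tambara ideal containing `x ∈ T(G/H)`. -/
noncomputable def span {H : Subgroup G} (x : T.level H) : T.TambaraIdeal := sInf {K | x ∈ K.level H}

/-- A Tambara ideal `P` is prime if it is proper and `IJ ⊆ P` implies `I ⊆ P` or `J ⊆ P`. -/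
structure IsPrime (P : T.TambaraIdeal) : Prop where
  ne_top : P ≠ ⊤
  le_or_le : ∀ I J : T.TambaraIdeal, I * J ≤ P → I ≤ P ∨ J ≤ P

/-- Level `G/H` of Nakaoka's radical `√I`: all `x ∈ T(G/H)` with `⟨x⟩ⁿ ⊆ I` for some `n`. -/
def nakaokaRadical (I : T.TambaraIdeal) (H : Subgroup G) : Set (T.level H) :=
  {x | ∃ n : ℕ, span x ^ n ≤ I}

end TambaraIdeal

end TambaraFunctor

/-! One inclusion is immediate, since `x ^ n` lies in level `H` of `⟨x⟩ⁿ`. For the other, suppose `x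
^ n ∈ I(G/H)`; some power of `⟨x⟩` must lie in `I`. By the exponential formula and base change,
`⟨x⟩ᵐ` consists of elements `T_u(c · N_v R_w x)` with `v : A → B` having at least `m` points in
every fibre (`normIdeal`, `span_pow_le_ofNormIdeal`): multiplying two such elements adds the sizes
of fibres, and further norms along surjections do not shrink them.

After restriction to an orbit `B = G/L`, give each point of `A` the type consisting of its
stabilizer and its images in `G/L` and `G/H`. The number of types is bounded in terms of `G` alone,
so for `m` large some type has at least `n|G|` points. An orbit has at most `|G|` points, so at
least `n` orbits of `A` are isomorphic over `G/L` and `G/H`. They contribute the same factor, so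
`N_v R_w x` is divisible by `(N_p R_q x)ⁿ = N_p R_q (xⁿ)`, which lies in `I`
(`nm_res_mem_of_pow_mem`).

Applied to a prime `P`, this shows that the levels of `P` are radical ideals, so every prime above
`I` contains the levelwise radical. Conversely, if no power of `x` lies in `I(G/H)`, a Tambara ideal
above `I` that is maximal with this property is prime (`exists_isPrime_of_forall_pow_notMem`). This
works as in commutative algebra because levelwise sums of Tambara ideals are Tambara ideals
(`nm_mem_sup`). -/

namespace FinGSet

/-! ### Pullbacks and dependent products of finite `G`-sets -/

variable {G : Type u} [Group G]

/-- A `G`-stable subset of a finite type with `G`-action, as a finite `G`-set. -/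
def ofSub {X : Type u} [MulAction G X] [Finite X] (S : SubMulAction G X) : FinGSet G := ⟨S⟩

/-- The pullback of two maps of finite `G`-sets. -/
def pullback {X Y Z : FinGSet G} (f : X →[G] Z) (g : Y →[G] Z) : FinGSet G :=
  ofSub (X := X × Y)
    { carrier := {p | f p.1 = g p.2}
      smul_mem' := fun c p (hp : f p.1 = g p.2) => by
        change f (c • p.1) = g (c • p.2)
        rw [map_smul, map_smul, hp] }

def pullbackFst {X Y Z : FinGSet G} (f : X →[G] Z) (g : Y →[G] Z) : pullback f g →[G] X where
  toFun p := p.1.1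
  map_smul' _ _ := rfl

def pullbackSnd {X Y Z : FinGSet G} (f : X →[G] Z) (g : Y →[G] Z) : pullback f g →[G] Y where
  toFun p := p.1.2
  map_smul' _ _ := rfl

theorem isPullback_pullback {X Y Z : FinGSet G} (f : X →[G] Z) (g : Y →[G] Z) :
    IsPullback (pullbackFst f g) (pullbackSnd f g) f g where
  comm w := w.2
  existsUnique x y h :=
    ⟨⟨(x, y), h⟩, ⟨rfl, rfl⟩, fun _ hw => Subtype.ext (Prod.ext hw.1 hw.2)⟩

/-- Ensures that base change does not lower the size of the fibres, the weight in `IsNormMultiple`.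
-/
theorem IsPullback.card_fibre_le {W X Y Z : FinGSet G} {g' : W →[G] X} {f' : W →[G] Y}
    {f : X →[G] Z} {g : Y →[G] Z} (h : IsPullback g' f' f g) (x : X) :
    Nat.card {y // g y = f x} ≤ Nat.card {w // g' w = x} := by
  choose k hk _ using h.existsUnique
  refine Nat.card_le_card_of_injective
    (fun y : {y // g y = f x} => (⟨k x y y.2.symm, (hk x y y.2.symm).1⟩ : {w // g' w = x})) ?_
  intro y y' e
  have e' : k x y y.2.symm = k x y' y'.2.symm := congrArg Subtype.val e
  apply Subtype.ext
  rw [← (hk x y y.2.symm).2, ← (hk x y' y'.2.symm).2, e']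

open scoped Pointwise in
/-- The dependent product `Π_f g`: the points over `z` are the images of the sections of `g`
over the fibre of `f` at `z`. -/
def depProd {X Y Z : FinGSet G} (g : X →[G] Y) (f : Y →[G] Z) : FinGSet G :=
  ofSub (X := Z × Set X)
    -- Encoding a section by its image lets `G` act by translating subsets, with no transport
    -- between fibres.
    { carrier := {p | (∀ x ∈ p.2, f (g x) = p.1) ∧ ∀ y, f y = p.1 → ∃! x, x ∈ p.2 ∧ g x = y}
      smul_mem' := by
        rintro c ⟨z, S⟩ ⟨h₁, h₂⟩
        refine ⟨?_, fun y hy => ?_⟩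
        · rintro _ ⟨x, hx, rfl⟩
          change f (g (c • x)) = c • z
          rw [map_smul, map_smul, h₁ x hx]
        · have hy' : f y = c • z := hy
          obtain ⟨x, ⟨hx, hxy⟩, hu⟩ := h₂ (c⁻¹ • y) (by rw [map_smul, hy', inv_smul_smul])
          refine ⟨c • x, ⟨Set.smul_mem_smul_set hx, by rw [map_smul, hxy, smul_inv_smul]⟩, ?_⟩
          rintro _ ⟨⟨w, hw, rfl⟩, hw'⟩
          have hw'' : g (c • w) = y := hw'
          exact congrArg (c • ·) (hu w ⟨hw, by rw [← hw'', map_smul, inv_smul_smul]⟩) }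

def depProdMap {X Y Z : FinGSet G} (g : X →[G] Y) (f : Y →[G] Z) : depProd g f →[G] Z where
  toFun p := p.1.1
  map_smul' _ _ := rfl

open scoped Pointwise in
/-- The evaluation object of the dependent product. -/
def depEval {X Y Z : FinGSet G} (g : X →[G] Y) (f : Y →[G] Z) : FinGSet G :=
  ofSub (X := depProd g f × X)
    { carrier := {e | e.2 ∈ e.1.1.2}
      smul_mem' := fun _ _ he => Set.smul_mem_smul_set he }

def depEvalPoint {X Y Z : FinGSet G} (g : X →[G] Y) (f : Y →[G] Z) : depEval g f →[G] X where
  toFun e := e.1.2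
  map_smul' _ _ := rfl

def depEvalProd {X Y Z : FinGSet G} (g : X →[G] Y) (f : Y →[G] Z) :
    depEval g f →[G] depProd g f where
  toFun e := e.1.1
  map_smul' _ _ := rfl

theorem isExponential_depProd {X Y Z : FinGSet G} (g : X →[G] Y) (f : Y →[G] Z) :
    IsExponential g f (depEvalPoint g f) (g.comp (depEvalPoint g f)) (depEvalProd g f)
      (depProdMap g f) where
  comm _ := rfl
  isPullback :=
    { comm := fun e => e.1.1.2.1 _ e.2
      existsUnique := fun y p h => by
        obtain ⟨x, ⟨hx, hxy⟩, hu⟩ := p.2.2 y h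
        refine ⟨⟨(p, x), hx⟩, ⟨hxy, rfl⟩, ?_⟩
        rintro ⟨⟨p', x'⟩, hx'⟩ ⟨h₁, h₂⟩
        obtain rfl : p' = p := h₂
        exact Subtype.ext (Prod.ext rfl (hu x' ⟨hx', h₁⟩)) }
  existsUnique z s hs := by
    refine ⟨⟨(z, Set.range s), ?_, ?_⟩, ⟨rfl, ?_⟩, ?_⟩
    · rintro _ ⟨y, rfl⟩
      change f (g (s y)) = z
      rw [hs, y.2]
    · intro y hy
      refine ⟨s ⟨y, hy⟩, ⟨⟨_, rfl⟩, hs _⟩, ?_⟩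
      rintro _ ⟨⟨y', rfl⟩, h⟩
      exact congrArg s (Subtype.ext ((hs y').symm.trans h))
    · rintro ⟨⟨p, x⟩, hx⟩ y h₁ h₂
      obtain rfl : p = _ := h₁
      obtain ⟨y', hy'⟩ := hx
      have hx' : s y' = x := hy'
      subst hx'
      exact congrArg s (Subtype.ext ((hs y').symm.trans h₂))
    · rintro ⟨⟨z', S⟩, h₁, h₂⟩ ⟨h, h₃⟩
      obtain rfl : z' = z := h
      refine Subtype.ext (Prod.ext rfl (Set.ext fun x => ⟨fun hx => ?_, ?_⟩))
      · exact ⟨⟨g x, h₁ x hx⟩, (h₃ ⟨(⟨(z', S), h₁, h₂⟩, x), hx⟩ ⟨g x, h₁ x hx⟩ rfl rfl).symm⟩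
      · rintro ⟨y, rfl⟩
        obtain ⟨x, ⟨hx, hxy⟩, -⟩ := h₂ y y.2
        have := h₃ ⟨(⟨(z', S), h₁, h₂⟩, x), hx⟩ y rfl hxy
        rw [← this]
        exact hx

/-- The complement of the orbit of a point. -/
def orbitCompl {X : FinGSet G} (x : X) : FinGSet G :=
  ofSub (X := X)
    { carrier := (MulAction.orbit G x)ᶜ
      smul_mem' := fun c y hy ⟨d, hd⟩ => hy ⟨c⁻¹ * d, by
        change (c⁻¹ * d) • x = y
        rw [mul_smul, inv_smul_eq_iff]
        exact hd⟩ }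

def orbitComplIncl {X : FinGSet G} (x : X) : orbitCompl x →[G] X where
  toFun y := y.1
  map_smul' _ _ := rfl

theorem card_orbitCompl_lt {X : FinGSet G} (x : X) : Nat.card (orbitCompl x) < Nat.card X :=
  Finite.card_subtype_lt (p := fun y => y ∈ (MulAction.orbit G x)ᶜ)
    (x := x) (fun h => h (MulAction.mem_orbit_self x))

/-! ### Orbits and the maps between them -/

section Orbit

variable [Finite G]

/-- The map `G/Q → X`, `gQ ↦ gx`, for a point `x` fixed by `Q`. -/
def orbitLift {X : FinGSet G} {Q : Subgroup G} (x : X) (h : Q ≤ MulAction.stabilizer G x) :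
    orbit Q →[G] X where
  toFun := Quotient.lift (fun g : G => g • x) (fun a b hab => by
    have h' := h (QuotientGroup.leftRel_apply.1 hab)
    rw [MulAction.mem_stabilizer_iff, mul_smul, inv_smul_eq_iff] at h'
    exact h'.symm)
  map_smul' c y := by
    induction y using QuotientGroup.induction_on with
    | H y => exact mul_smul c y x

/-- The base point of `G/H`. -/
def basePoint (H : Subgroup G) : orbit H := ((1 : G) : G ⧸ H)

theorem exists_smul_basePoint {H : Subgroup G} (y : orbit H) : ∃ g : G, y = g • basePoint H := by
  induction y using QuotientGroup.induction_on with
  | H g => exact ⟨g, congrArg (Quotient.mk _) (mul_one g).symm⟩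

theorem orbitLift_basePoint {X : FinGSet G} {Q : Subgroup G} (x : X)
    (h : Q ≤ MulAction.stabilizer G x) : orbitLift x h (basePoint Q) = x :=
  one_smul G x

theorem orbit_hom_ext {H : Subgroup G} {X : FinGSet G} {f g : orbit H →[G] X}
    (h : f (basePoint H) = g (basePoint H)) : f = g := by
  ext y
  obtain ⟨c, rfl⟩ := exists_smul_basePoint y
  rw [map_smul, map_smul, h]

theorem smul_basePoint_eq_iff {H : Subgroup G} (g : G) :
    g • basePoint H = basePoint H ↔ g ∈ H := by
  change ((g * 1 : G) : G ⧸ H) = ((1 : G) : G ⧸ H) ↔ _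
  rw [eq_comm, QuotientGroup.eq]
  simp

theorem orbitLift_injective {X : FinGSet G} {Q : Subgroup G} (x : X)
    (h : Q = MulAction.stabilizer G x) : Function.Injective (orbitLift x h.le) := by
  intro y y' e
  obtain ⟨c, rfl⟩ := exists_smul_basePoint y
  obtain ⟨c', rfl⟩ := exists_smul_basePoint y'
  rw [map_smul, map_smul, orbitLift_basePoint] at e
  rw [← inv_smul_eq_iff, ← mul_smul, smul_basePoint_eq_iff, h, MulAction.mem_stabilizer_iff,
    mul_smul, e, inv_smul_smul]

theorem orbitLift_mem_orbit {X : FinGSet G} {Q : Subgroup G} (x : X)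
    (h : Q ≤ MulAction.stabilizer G x) (y : orbit Q) :
    orbitLift x h y ∈ MulAction.orbit G x := by
  obtain ⟨c, rfl⟩ := exists_smul_basePoint y
  rw [map_smul, orbitLift_basePoint]
  exact ⟨c, rfl⟩

/-- `Q` is a variable so that points with equal stabilizers give maps out of the same orbit `G/Q`.
-/
theorem bijective_desc_orbitLift {X : FinGSet G} {Q : Subgroup G} (x : X)
    (h : Q = MulAction.stabilizer G x) :
    Function.Bijective (desc (orbitLift x h.le) (orbitComplIncl x)) := by
  constructor
  · rintro (y | y) (y' | y') e
    · exact congrArg Sum.inl (orbitLift_injective x h e)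
    · exact absurd (show (y'.1 : X) ∈ MulAction.orbit G x from
        (show orbitLift x h.le y = y'.1 from e) ▸ orbitLift_mem_orbit x h.le y) y'.2
    · exact absurd (show (y.1 : X) ∈ MulAction.orbit G x from
        (show y.1 = orbitLift x h.le y' from e) ▸ orbitLift_mem_orbit x h.le y') y.2
    · exact congrArg Sum.inr (Subtype.ext e)
  · intro y
    by_cases hy : y ∈ MulAction.orbit G x
    · obtain ⟨c, rfl⟩ := hy
      exact ⟨Sum.inl (c • basePoint Q), by
        change orbitLift x h.le (c • basePoint Q) = c • x
        rw [map_smul, orbitLift_basePoint]⟩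
    · exact ⟨Sum.inr ⟨y, hy⟩, rfl⟩

theorem surjective_of_orbit {X : FinGSet G} [Nonempty X] {K : Subgroup G} (f : X →[G] orbit K) :
    Function.Surjective f := by
  intro y
  obtain ⟨x⟩ := ‹Nonempty X›
  obtain ⟨c, hc⟩ := exists_smul_basePoint (f x)
  obtain ⟨d, rfl⟩ := exists_smul_basePoint y
  exact ⟨(d * c⁻¹) • x, by rw [map_smul, hc, mul_smul, inv_smul_smul]⟩

/-- The inverse of the canonical isomorphism `G/H → G/gHg⁻¹`. -/
def orbitConjInv (g : G) (H : Subgroup G) : orbit (conjSubgroup g H) →[G] orbit H :=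
  (orbitMap (show conjSubgroup g⁻¹ (conjSubgroup g H) ≤ H by
    rintro _ ⟨_, ⟨a, ha, rfl⟩, rfl⟩
    simpa [MulAut.conj_apply, mul_assoc] using ha)).comp (orbitConj g⁻¹ (conjSubgroup g H))

theorem orbitConjInv_orbitConj (g : G) (H : Subgroup G) (x : orbit H) :
    orbitConjInv g H (orbitConj g H x) = x := by
  induction x using QuotientGroup.induction_on with
  | H x => exact congrArg (Quotient.mk _) (by simp)

theorem orbitConj_orbitConjInv (g : G) (H : Subgroup G) (x : orbit (conjSubgroup g H)) :
    orbitConj g H (orbitConjInv g H x) = x := by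
  induction x using QuotientGroup.induction_on with
  | H x => exact congrArg (Quotient.mk _) (by simp)

/-- If the base point goes to `cK`, equivariance forces `c⁻¹Hc ≤ K`, so `g = c⁻¹` works. Hence the
closure conditions of a Tambara ideal extend to all maps of orbits. -/
theorem exists_eq_orbitMap_comp_orbitConj {H K : Subgroup G} (f : orbit H →[G] orbit K) :
    ∃ (g : G) (h : conjSubgroup g H ≤ K), f = (orbitMap h).comp (orbitConj g H) := by
  obtain ⟨c, hc⟩ := exists_smul_basePoint (f (basePoint H))
  have h : conjSubgroup c⁻¹ H ≤ K := by
    rintro _ ⟨a, ha, rfl⟩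
    have := congrArg f ((smul_basePoint_eq_iff a).2 ha)
    rw [map_smul, hc, ← inv_smul_eq_iff, ← mul_smul, ← mul_smul, smul_basePoint_eq_iff] at this
    simpa [MulAut.conj_apply, mul_assoc] using this
  refine ⟨c⁻¹, h, orbit_hom_ext (hc.trans ?_)⟩
  exact congrArg (Quotient.mk _) (by simp)

end Orbit

end FinGSet

/-! ### Transfers and decomposition into orbits; through `multiplicative` the same results hold for
norms -/

namespace SemiMackeyFunctor

open FinGSet

variable {G : Type u} [Group G] (M : SemiMackeyFunctor.{u, v} G)

theorem tr_op {X Y : FinGSet G} (f : X →[G] Y) (a b : M.obj X) :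
    M.tr f (M.op a b) = M.op (M.tr f a) (M.tr f b) := by
  have h : f.comp (fold X) = desc f f := by
    ext x; cases x <;> rfl
  rw [← M.tr_desc_pair, ← h, M.tr_comp]
  rfl

theorem tr_unit {X Y : FinGSet G} (f : X →[G] Y) : M.tr f (M.unit X) = M.unit Y := by
  have h : f.comp (fromEmpty X) = fromEmpty Y := by
    ext x; exact x.elim
  unfold unit
  rw [← M.tr_comp, h]

theorem tr_of_isEmpty {X Y : FinGSet G} [IsEmpty X] (f : X →[G] Y) (a : M.obj X) :
    M.tr f a = M.unit Y := by
  let e : X →[G] empty G := ⟨fun x => isEmptyElim x, fun _ x => isEmptyElim x⟩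
  have h := M.tr_eq_res (fromEmpty X) e (fun x => x.elim) (fun x => isEmptyElim x)
    (M.res (fromEmpty X) a)
  have h' : (fromEmpty X).comp e = MulActionHom.id G := by
    ext x; exact isEmptyElim x
  rw [← M.res_comp, h', M.res_id, M.eq_pt (M.res _ a)] at h
  rw [← h]
  exact M.tr_unit f

theorem res_unit {X Y : FinGSet G} (f : X →[G] Y) : M.res f (M.unit Y) = M.unit X := by
  have h := M.res_tr (fromEmpty X) (MulActionHom.id G) f (fromEmpty Y)
    ⟨fun x => x.elim, fun _ y => y.elim⟩ M.pt
  rwa [M.res_id] at h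

theorem tr_eq_op_of_bijective {A B X Y : FinGSet G} (i : A →[G] X) (j : B →[G] X)
    (h : Function.Bijective (desc i j)) (f : X →[G] Y) (a : M.obj X) :
    M.tr f a = M.op (M.tr (f.comp i) (M.res i a)) (M.tr (f.comp j) (M.res j a)) := by
  obtain ⟨k, h₁, h₂⟩ := Function.bijective_iff_has_inverse.1 h
  let e : X →[G] sum A B := ⟨k, fun c x => h.1 (by
    rw [map_smul]
    exact (h₂ _).trans (congrArg (c • ·) (h₂ x).symm))⟩
  have h₃ : M.res (desc i j) a = M.pair (M.res i a) (M.res j a) := by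
    apply M.sum_ext
    · rw [M.res_inl_pair, ← M.res_comp]; rfl
    · rw [M.res_inr_pair, ← M.res_comp]; rfl
  have h₄ : a = M.tr (desc i j) (M.res (desc i j) a) := by
    rw [M.tr_eq_res (desc i j) e h₁ h₂, ← M.res_comp]
    have : (desc i j).comp e = MulActionHom.id G := by
      ext x; exact h₂ x
    rw [this, M.res_id]
  conv_lhs => rw [h₄, h₃, ← M.tr_comp]
  rw [← M.tr_desc_pair]
  congr 1
  ext x; cases x <;> rfl

/-- Splitting off one orbit writes the transfer as a sum of a transfer from that orbit and one from
a smaller `G`-set. -/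
theorem tr_induction [Finite G] {Y : FinGSet G} (C : M.obj Y → Prop) (unit : C (M.unit Y))
    (op : ∀ a b, C a → C b → C (M.op a b)) {X : FinGSet G} (f : X →[G] Y) (a : M.obj X)
    (h : ∀ (L : Subgroup G) (g : orbit L →[G] X), C (M.tr (f.comp g) (M.res g a))) :
    C (M.tr f a) := by
  induction hn : Nat.card X using Nat.strong_induction_on generalizing X with
  | _ n ih =>
    rcases isEmpty_or_nonempty X with hX | ⟨⟨x⟩⟩
    · rwa [M.tr_of_isEmpty]
    · rw [M.tr_eq_op_of_bijective _ _ (bijective_desc_orbitLift x rfl)]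
      refine op _ _ (h _ _) (ih _ (hn ▸ card_orbitCompl_lt x) _ _ (fun L g => ?_) rfl)
      have := h L ((orbitComplIncl x).comp g)
      rwa [M.res_comp] at this

end SemiMackeyFunctor

theorem Ideal.sup_mul_sup_le_of_mul_le {R : Type*} [CommRing R] {𝔭 𝔞 𝔟 : Ideal R}
    (h : 𝔞 * 𝔟 ≤ 𝔭) : (𝔭 ⊔ 𝔞) * (𝔭 ⊔ 𝔟) ≤ 𝔭 := by
  rw [Ideal.sup_mul, Ideal.mul_sup 𝔞]
  exact sup_le Ideal.mul_le_left (sup_le Ideal.mul_le_right h)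

/-! ### Frobenius reciprocity and the ring-theoretic form of the structure maps -/

namespace SemiTambaraFunctor

open FinGSet

variable {G : Type u} [Group G] (S : SemiTambaraFunctor.{u, v} G)

/-- Frobenius reciprocity. -/
theorem mul_tr {B Y : FinGSet G} (u : B →[G] Y) (a : S.obj Y) (b : S.obj B) :
    a * S.tr u b = S.tr u (S.res u a * b) := by
  have h₁ : S.pair a (S.tr u b) = S.tr (sumMap (MulActionHom.id G) u) (S.pair a b) := by
    rw [S.tr_sumMap_pair, S.tr_id]
  -- A section of `id ⊔ u` over the two points above `z` is just a point of `B` above `z`, so the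
  -- dependent product is `u` itself.
  have hE : IsExponential (sumMap (MulActionHom.id G : Y →[G] Y) u) (fold Y)
      (sumMap u (MulActionHom.id G)) (sumMap u u) (fold B) u := by
    refine ⟨by rintro (x | x) <;> rfl, ⟨by rintro (x | x) <;> rfl, ?_⟩, ?_⟩
    · rintro (y | y) x h
      · obtain rfl : y = u x := h
        refine ⟨Sum.inl x, ⟨rfl, rfl⟩, ?_⟩
        rintro (w | w) ⟨h₁, h₂⟩
        · exact congrArg Sum.inl h₂
        · exact absurd h₁ Sum.inr_ne_inl
      · obtain rfl : y = u x := h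
        refine ⟨Sum.inr x, ⟨rfl, rfl⟩, ?_⟩
        rintro (w | w) ⟨h₁, h₂⟩
        · exact absurd h₁ Sum.inl_ne_inr
        · exact congrArg Sum.inr h₂
    · intro z s hs
      have hl : s ⟨Sum.inl z, rfl⟩ = Sum.inl z := by
        have h := hs ⟨Sum.inl z, rfl⟩
        rcases hx : s ⟨Sum.inl z, rfl⟩ with x | x <;> rw [hx] at h
        · exact congrArg Sum.inl (Sum.inl_injective h)
        · exact absurd h Sum.inr_ne_inl
      obtain ⟨b, hr, hb⟩ : ∃ b, s ⟨Sum.inr z, rfl⟩ = Sum.inr b ∧ u b = z := by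
        have h := hs ⟨Sum.inr z, rfl⟩
        rcases hx : s ⟨Sum.inr z, rfl⟩ with x | x <;> rw [hx] at h
        · exact absurd h Sum.inl_ne_inr
        · exact ⟨x, rfl, Sum.inr_injective h⟩
      refine ⟨b, ⟨hb, ?_⟩, ?_⟩
      · rintro (w | w) ⟨y | y, hy⟩ h₁ h₂ <;> cases hy <;> cases h₁
        · exact (congrArg Sum.inl hb).trans hl.symm
        · exact absurd h₂ Sum.inl_ne_inr
        · exact absurd h₂ Sum.inr_ne_inl
        · exact hr.symm
      · rintro b' ⟨h₁, h₂⟩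
        have h := h₂ (Sum.inr b') ⟨Sum.inr z, rfl⟩ rfl (congrArg Sum.inr h₁)
        rw [hr] at h
        exact Sum.inr_injective h
  have h₂ : S.res (sumMap u (MulActionHom.id G)) (S.pair a b) = S.pair (S.res u a) b := by
    apply S.sum_ext
    · rw [← S.res_comp, S.res_inl_pair]
      change S.res ((inl Y B).comp u) _ = _
      rw [S.res_comp, S.res_inl_pair]
    · rw [← S.res_comp, S.res_inr_pair]
      exact S.res_inr_pair _ _
  rw [S.mul_def, h₁, S.nm_tr _ _ _ _ _ _ hE, h₂, ← S.mul_def]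

/-- Both are restriction along the inverse. Thus `conj_mem`, stated with transfers, also serves for
norms. -/
theorem nm_eq_tr {X Y : FinGSet G} (e : X →[G] Y) (e' : Y →[G] X)
    (h₁ : ∀ x, e' (e x) = x) (h₂ : ∀ y, e (e' y) = y) (a : S.obj X) : S.nm e a = S.tr e a :=
  (S.multiplicative.tr_eq_res e e' h₁ h₂ a).trans (S.tr_eq_res e e' h₁ h₂ a).symm

end SemiTambaraFunctor

namespace TambaraFunctor

open FinGSet

variable {G : Type u} [Group G] (T : TambaraFunctor.{u, v} G)

/-- Restriction as a ring homomorphism. -/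
noncomputable def resHom {X Y : FinGSet G} (f : X →[G] Y) : T.obj Y →+* T.obj X where
  toFun := T.res f
  map_one' := T.multiplicative.res_unit f
  map_mul' := T.multiplicative.res_op f
  map_zero' := T.toSemiMackeyFunctor.res_unit f
  map_add' := T.toSemiMackeyFunctor.res_op f

/-- Transfer as a homomorphism of additive groups. -/
noncomputable def trHom {X Y : FinGSet G} (f : X →[G] Y) : T.obj X →+ T.obj Y where
  toFun := T.tr f
  map_zero' := T.toSemiMackeyFunctor.tr_unit f
  map_add' := T.toSemiMackeyFunctor.tr_op f

/-- Norm as a homomorphism of multiplicative monoids. -/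
noncomputable def nmHom {X Y : FinGSet G} (f : X →[G] Y) : T.obj X →* T.obj Y where
  toFun := T.nm f
  map_one' := T.multiplicative.tr_unit f
  map_mul' := T.multiplicative.tr_op f

theorem res_mul {X Y : FinGSet G} (f : X →[G] Y) (a b : T.obj Y) :
    T.res f (a * b) = T.res f a * T.res f b := map_mul (T.resHom f) a b

theorem res_pow {X Y : FinGSet G} (f : X →[G] Y) (a : T.obj Y) (n : ℕ) :
    T.res f (a ^ n) = T.res f a ^ n := map_pow (T.resHom f) a n

theorem tr_add {X Y : FinGSet G} (f : X →[G] Y) (a b : T.obj X) :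
    T.tr f (a + b) = T.tr f a + T.tr f b := map_add (T.trHom f) a b

theorem nm_mul {X Y : FinGSet G} (f : X →[G] Y) (a b : T.obj X) :
    T.nm f (a * b) = T.nm f a * T.nm f b := map_mul (T.nmHom f) a b

theorem nm_pow {X Y : FinGSet G} (f : X →[G] Y) (a : T.obj X) (n : ℕ) :
    T.nm f (a ^ n) = T.nm f a ^ n := map_pow (T.nmHom f) a n

theorem mul_tr {B Y : FinGSet G} (u : B →[G] Y) (a : T.obj Y) (b : T.obj B) :
    a * T.tr u b = T.tr u (T.res u a * b) := T.toSemiTambaraFunctor.mul_tr u a b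

theorem nm_eq_mul_of_bijective {A B X Y : FinGSet G} (i : A →[G] X) (j : B →[G] X)
    (h : Function.Bijective (desc i j)) (f : X →[G] Y) (a : T.obj X) :
    T.nm f a = T.nm (f.comp i) (T.res i a) * T.nm (f.comp j) (T.res j a) :=
  T.multiplicative.tr_eq_op_of_bijective i j h f a

theorem nm_desc_pair {X Y Z : FinGSet G} (f : X →[G] Z) (g : Y →[G] Z) (a : T.obj X)
    (b : T.obj Y) : T.nm (desc f g) (T.pair a b) = T.nm f a * T.nm g b :=
  T.multiplicative.tr_desc_pair f g a b

variable [Finite G]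

/-- Needed because Tambara ideals have levels only at orbits, while dependent products are arbitrary
`G`-sets. -/
theorem tr_mem_of_forall {K : Subgroup G} (𝔞 : Ideal (T.level K)) {X : FinGSet G}
    (f : X →[G] orbit K) (a : T.obj X)
    (h : ∀ (L : Subgroup G) (g : orbit L →[G] X), T.tr (f.comp g) (T.res g a) ∈ 𝔞) :
    T.tr f a ∈ 𝔞 :=
  T.tr_induction (· ∈ 𝔞) 𝔞.zero_mem (fun _ _ => 𝔞.add_mem) f a h

/-! ### Sums, products and powers of Tambara ideals, and existence of primes -/

namespace TambaraIdeal

variable {T}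

theorem tr_hom_mem (I : T.TambaraIdeal) {H K : Subgroup G} (f : orbit H →[G] orbit K)
    {a : T.level H} (ha : a ∈ I.level H) : T.tr f a ∈ I.level K := by
  obtain ⟨g, h, rfl⟩ := exists_eq_orbitMap_comp_orbitConj f
  rw [T.tr_comp]
  exact I.tr_mem h (I.conj_mem g ha)

theorem nm_hom_mem (I : T.TambaraIdeal) {H K : Subgroup G} (f : orbit H →[G] orbit K)
    {a : T.level H} (ha : a ∈ I.level H) : T.nm f a ∈ I.level K := by
  obtain ⟨g, h, rfl⟩ := exists_eq_orbitMap_comp_orbitConj f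
  rw [T.nm_comp, T.nm_eq_tr (orbitConj g H) (orbitConjInv g H) (orbitConjInv_orbitConj g H)
    (orbitConj_orbitConjInv g H)]
  exact I.nm_mem h (I.conj_mem g ha)

theorem res_hom_mem (I : T.TambaraIdeal) {H K : Subgroup G} (f : orbit H →[G] orbit K)
    {a : T.level K} (ha : a ∈ I.level K) : T.res f a ∈ I.level H := by
  obtain ⟨g, h, rfl⟩ := exists_eq_orbitMap_comp_orbitConj f
  rw [T.res_comp, ← T.tr_eq_res (orbitConjInv g H) (orbitConj g H) (orbitConj_orbitConjInv g H)
    (orbitConjInv_orbitConj g H)]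
  exact I.tr_hom_mem _ (I.res_mem h ha)

/-- A family of ideals closed under restrictions, transfers and norms along all maps of orbits. -/
noncomputable def ofHoms (level : ∀ H : Subgroup G, Ideal (T.level H))
    (res : ∀ {H K : Subgroup G} (f : orbit H →[G] orbit K) (a : T.level K),
      a ∈ level K → T.res f a ∈ level H)
    (tr : ∀ {H K : Subgroup G} (f : orbit H →[G] orbit K) (a : T.level H),
      a ∈ level H → T.tr f a ∈ level K)
    (nm : ∀ {H K : Subgroup G} (f : orbit H →[G] orbit K) (a : T.level H),
      a ∈ level H → T.nm f a ∈ level K) : T.TambaraIdeal where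
  level := level
  res_mem _ _ := res _ _
  tr_mem _ _ := tr _ _
  nm_mem _ _ := nm _ _
  conj_mem _ _ _ := tr _ _

/-- A single orbit of `X` lands in one of the two copies of `G/H`, so its factor involves only `a`
or only `b`; the other factor is absorbed. Nonemptiness matters, as the norm from the empty set is
`1`. -/
theorem nm_pair_mem_sup (I J : T.TambaraIdeal) {H K : Subgroup G} {a b : T.level H}
    (ha : a ∈ I.level H) (hb : b ∈ J.level H) {X : FinGSet G} [Nonempty X]
    (e : X →[G] sum (orbit H) (orbit H)) (f : X →[G] orbit K) :
    T.nm f (T.res e (T.pair a b)) ∈ I.level K ⊔ J.level K := by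
  obtain ⟨x⟩ := ‹Nonempty X›
  rw [T.nm_eq_mul_of_bijective _ _ (bijective_desc_orbitLift x rfl)]
  apply Ideal.mul_mem_right
  rw [← T.res_comp]
  set e' := e.comp (orbitLift x le_rfl)
  rcases he : e' (basePoint _) with y | y
  · have hs : MulAction.stabilizer G x ≤ MulAction.stabilizer G y := fun g hg => by
      have := congrArg e' ((smul_basePoint_eq_iff g).2 hg)
      rw [map_smul, he] at this
      exact Sum.inl_injective this
    have : e' = (inl _ _).comp (orbitLift y hs) := orbit_hom_ext (he.trans
      (congrArg Sum.inl (orbitLift_basePoint y hs)).symm)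
    rw [this, T.res_comp, T.res_inl_pair]
    exact Ideal.mem_sup_left (I.nm_hom_mem _ (I.res_hom_mem _ ha))
  · have hs : MulAction.stabilizer G x ≤ MulAction.stabilizer G y := fun g hg => by
      have := congrArg e' ((smul_basePoint_eq_iff g).2 hg)
      rw [map_smul, he] at this
      exact Sum.inr_injective this
    have : e' = (inr _ _).comp (orbitLift y hs) := orbit_hom_ext (he.trans
      (congrArg Sum.inr (orbitLift_basePoint y hs)).symm)
    rw [this, T.res_comp, T.res_inr_pair]
    exact Ideal.mem_sup_right (J.nm_hom_mem _ (J.res_hom_mem _ hb))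

theorem tr_mem_sup (I J : T.TambaraIdeal) {H K : Subgroup G} (f : orbit H →[G] orbit K)
    {a : T.level H} (ha : a ∈ I.level H ⊔ J.level H) : T.tr f a ∈ I.level K ⊔ J.level K := by
  obtain ⟨b, hb, c, hc, rfl⟩ := Submodule.mem_sup.1 ha
  rw [T.tr_add]
  exact add_mem (Ideal.mem_sup_left (I.tr_hom_mem f hb)) (Ideal.mem_sup_right (J.tr_hom_mem f hc))

/-- The sum `b + c` is a transfer along the fold map, so the exponential formula makes its norm a
transfer of norms of restrictions of the pair `(b, c)`. -/
theorem nm_mem_sup (I J : T.TambaraIdeal) {H K : Subgroup G} (f : orbit H →[G] orbit K)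
    {a : T.level H} (ha : a ∈ I.level H ⊔ J.level H) : T.nm f a ∈ I.level K ⊔ J.level K := by
  obtain ⟨b, hb, c, hc, rfl⟩ := Submodule.mem_sup.1 ha
  rw [T.add_def, T.nm_tr _ _ _ _ _ _ (isExponential_depProd (fold (orbit H)) f)]
  refine T.tr_mem_of_forall _ _ _ fun L g => I.tr_mem_sup J _ ?_
  rw [T.res_nm _ _ _ _ (isPullback_pullback g _), ← T.res_comp]
  -- The map `f` is onto because its target is an orbit, so the fibres of its pullback are nonempty.
  have : Nonempty (pullback g (depEvalProd (fold (orbit H)) f)) := by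
    have : Nonempty (orbit H) := ⟨basePoint H⟩
    obtain ⟨y, hy⟩ := surjective_of_orbit f (depProdMap _ f (g (basePoint L)))
    obtain ⟨e, ⟨-, he⟩, -⟩ :=
      (isExponential_depProd (fold (orbit H)) f).isPullback.existsUnique _ _ hy
    exact ⟨⟨(basePoint L, e), he.symm⟩⟩
  exact I.nm_pair_mem_sup J hb hc _ _

/-- The levelwise sum of two Tambara ideals. -/
noncomputable def sup (I J : T.TambaraIdeal) : T.TambaraIdeal :=
  ofHoms (fun H => I.level H ⊔ J.level H)
    (fun f a ha => by
      obtain ⟨b, hb, c, hc, rfl⟩ := Submodule.mem_sup.1 ha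
      have : T.res f (b + c) = T.res f b + T.res f c := map_add (T.resHom f) b c
      rw [this]
      exact add_mem (Ideal.mem_sup_left (I.res_hom_mem f hb))
        (Ideal.mem_sup_right (J.res_hom_mem f hc)))
    (fun f _ => I.tr_mem_sup J f) (fun f _ => I.nm_mem_sup J f)

theorem mem_sInf {A : Set T.TambaraIdeal} {H : Subgroup G} {x : T.level H} :
    x ∈ (sInf A).level H ↔ ∀ I ∈ A, x ∈ I.level H := by
  change x ∈ ⨅ I ∈ A, I.level H ↔ _
  simp only [Submodule.mem_iInf]

theorem mul_le_iff {I J K : T.TambaraIdeal} :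
    I * J ≤ K ↔ ∀ H, I.level H * J.level H ≤ K.level H := by
  constructor
  · intro h H x hx
    exact h H (mem_sInf.2 fun L hL => hL H hx)
  · intro h H x hx
    exact mem_sInf.1 hx K h

theorem mem_span_self {H : Subgroup G} (x : T.level H) : x ∈ (span x).level H :=
  mem_sInf.2 fun _ h => h

theorem span_le_iff {H : Subgroup G} {x : T.level H} {I : T.TambaraIdeal} :
    span x ≤ I ↔ x ∈ I.level H :=
  ⟨fun h => h H (mem_span_self x), fun h _ _ hy => mem_sInf.1 hy I h⟩

theorem pow_mem_pow {I : T.TambaraIdeal} {H : Subgroup G} {x : T.level H} (hx : x ∈ I.level H)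
    (n : ℕ) : x ^ n ∈ (I ^ n).level H := by
  induction n with
  | zero => trivial
  | succ n ih =>
    rw [_root_.pow_succ]
    exact mul_le_iff.1 (le_refl (I ^ n * I)) H (Ideal.mul_mem_mul ih hx)

theorem IsPrime.le_of_pow_le {P I : T.TambaraIdeal} (hP : P.IsPrime) {n : ℕ} (h : I ^ n ≤ P) :
    I ≤ P := by
  induction n with
  | zero => exact absurd (le_antisymm (fun _ _ _ => trivial) h) hP.ne_top
  | succ n ih => exact (hP.le_or_le _ _ h).elim ih id

/-- The union of a nonempty chain of Tambara ideals. -/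
noncomputable def chainUnion (C : Set T.TambaraIdeal) (hC : IsChain (· ≤ ·) C)
    (hne : C.Nonempty) : T.TambaraIdeal :=
  ofHoms
    (fun H =>
      { carrier := {a | ∃ I ∈ C, a ∈ I.level H}
        zero_mem' := ⟨_, hne.some_mem, zero_mem _⟩
        add_mem' := by
          rintro a b ⟨I, hI, ha⟩ ⟨J, hJ, hb⟩
          rcases hC.total hI hJ with h | h
          · exact ⟨J, hJ, add_mem (h H ha) hb⟩
          · exact ⟨I, hI, add_mem ha (h H hb)⟩
        smul_mem' := fun c a ⟨I, hI, ha⟩ => ⟨I, hI, Ideal.mul_mem_left _ c ha⟩ })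
    (fun f _ ⟨I, hI, ha⟩ => ⟨I, hI, I.res_hom_mem f ha⟩)
    (fun f _ ⟨I, hI, ha⟩ => ⟨I, hI, I.tr_hom_mem f ha⟩)
    (fun f _ ⟨I, hI, ha⟩ => ⟨I, hI, I.nm_hom_mem f ha⟩)

/-- Take `P` maximal among the Tambara ideals above `I` containing no power of `x`. If neither `A`
nor `B` lies in `P`, then `P + A` and `P + B` contain powers of `x`; were `AB ≤ P`, their product
would lie in `P`. Only level `H` enters this last step. -/
theorem exists_isPrime_of_forall_pow_notMem {I : T.TambaraIdeal} {H : Subgroup G} {x : T.level H}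
    (hx : ∀ n, x ^ n ∉ I.level H) : ∃ P : T.TambaraIdeal, P.IsPrime ∧ I ≤ P ∧ x ∉ P.level H := by
  obtain ⟨P, hIP, hP⟩ := zorn_le_nonempty₀ {J : T.TambaraIdeal | ∀ n, x ^ n ∉ J.level H}
    (fun C hCs hC J hJ => ⟨chainUnion C hC ⟨J, hJ⟩,
      fun n ⟨I, hI, h⟩ => hCs hI n h, fun I hI _ _ ha => ⟨I, hI, ha⟩⟩) I hx
  have hxP : x ∉ P.level H := by simpa using hP.prop 1
  have key : ∀ A : T.TambaraIdeal, ¬ A ≤ P → ∃ n, x ^ n ∈ P.level H ⊔ A.level H := by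
    intro A hA
    by_contra! h
    exact hA fun K a ha =>
      hP.le_of_ge (y := P.sup A) h (fun _ => le_sup_left) K (Ideal.mem_sup_right ha)
  refine ⟨P, ⟨fun h => hxP (h ▸ trivial), fun A B hAB => ?_⟩, hIP, hxP⟩
  by_contra! h
  obtain ⟨m, hm⟩ := key A h.1
  obtain ⟨n, hn⟩ := key B h.2
  refine hP.prop (m + n) ?_
  rw [pow_add]
  exact Ideal.sup_mul_sup_le_of_mul_le (mul_le_iff.1 hAB H) (Ideal.mul_mem_mul hm hn)

end TambaraIdeal

end TambaraFunctor

/-! ### Norm multiples of an element and the ideals that they generate under transfer -/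

namespace TambaraFunctor

open FinGSet

variable {G : Type u} [Group G] {T : TambaraFunctor.{u, v} G}

/-- The multiples in `T(B)` of the elements `N_v R_w x`, where `v : A → B` has fibres with at
least `m` points. -/
def IsNormMultiple {Z : FinGSet G} (x : T.obj Z) (m : ℕ) {B : FinGSet G} (b : T.obj B) : Prop :=
  ∃ (A : FinGSet G) (v : A →[G] B) (w : A →[G] Z) (c : T.obj B),
    (∀ y, m ≤ Nat.card {a // v a = y}) ∧ b = c * T.nm v (T.res w x)

namespace IsNormMultiple

variable {Z : FinGSet G} {x : T.obj Z} {m n : ℕ} {B C : FinGSet G}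

theorem res {b : T.obj B} (hb : IsNormMultiple x m b) (f : C →[G] B) :
    IsNormMultiple x m (T.res f b) := by
  obtain ⟨A, v, w, c, h, rfl⟩ := hb
  have hp := isPullback_pullback f v
  refine ⟨pullback f v, pullbackFst f v, w.comp (pullbackSnd f v), T.res f c,
    fun y => (h (f y)).trans (hp.card_fibre_le y), ?_⟩
  rw [T.res_mul, T.res_nm _ _ _ _ hp, T.res_comp]

theorem smul {b : T.obj B} (hb : IsNormMultiple x m b) (a : T.obj B) :
    IsNormMultiple x m (a * b) := by
  obtain ⟨A, v, w, c, h, rfl⟩ := hb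
  exact ⟨A, v, w, a * c, h, (mul_assoc _ _ _).symm⟩

/-- The product of two norms is the norm from the disjoint union, whose fibres are the unions of the
given ones. -/
theorem mul {b c : T.obj B} (hb : IsNormMultiple x m b) (hc : IsNormMultiple x n c) :
    IsNormMultiple x (m + n) (b * c) := by
  obtain ⟨A, v, w, d, h, rfl⟩ := hb
  obtain ⟨A', v', w', d', h', rfl⟩ := hc
  refine ⟨sum A A', desc v v', desc w w', d * d', fun y => ?_, ?_⟩
  · refine (add_le_add (h y) (h' y)).trans ?_
    rw [← Nat.card_sum]
    refine Nat.card_le_card_of_injective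
      (fun s : {a // v a = y} ⊕ {a // v' a = y} =>
        (Sum.elim (fun a => ⟨Sum.inl a.1, a.2⟩) (fun a => ⟨Sum.inr a.1, a.2⟩) s :
          {a : A.carrier ⊕ A'.carrier // desc v v' a = y})) ?_
    rintro (a | a) (a' | a') e
    · exact congrArg Sum.inl (Subtype.ext (Sum.inl_injective (congrArg Subtype.val e)))
    · exact absurd (congrArg Subtype.val e) Sum.inl_ne_inr
    · exact absurd (congrArg Subtype.val e) Sum.inr_ne_inl
    · exact congrArg Sum.inr (Subtype.ext (Sum.inr_injective (congrArg Subtype.val e)))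
  · have : T.res (desc w w') x = T.pair (T.res w x) (T.res w' x) := by
      apply T.sum_ext
      · rw [T.res_inl_pair, ← T.res_comp]; rfl
      · rw [T.res_inr_pair, ← T.res_comp]; rfl
    rw [this, T.nm_desc_pair]
    exact mul_mul_mul_comm _ _ _ _

/-- Surjectivity makes every fibre of `f ∘ v` contain a fibre of `v`. -/
theorem nm {b : T.obj B} (hb : IsNormMultiple x m b) (f : B →[G] C)
    (hf : Function.Surjective f) : IsNormMultiple x m (T.nm f b) := by
  obtain ⟨A, v, w, c, h, rfl⟩ := hb
  refine ⟨A, f.comp v, w, T.nm f c, fun y => ?_, by rw [T.nm_mul, T.nm_comp]⟩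
  obtain ⟨z, rfl⟩ := hf y
  refine (h z).trans (Nat.card_le_card_of_injective
    (fun a : {a // v a = z} => (⟨a.1, congrArg f a.2⟩ : {a // f.comp v a = f z})) ?_)
  intro a a' e
  have e' : a.1 = a'.1 := Subtype.mk.inj e
  exact Subtype.ext e'

theorem pair {b : T.obj B} {c : T.obj C} (hb : IsNormMultiple x m b)
    (hc : IsNormMultiple x m c) : IsNormMultiple x m (T.pair b c) := by
  obtain ⟨A, v, w, d, h, rfl⟩ := hb
  obtain ⟨A', v', w', d', h', rfl⟩ := hc
  refine ⟨sum A A', sumMap v v', desc w w', T.pair d d', ?_, ?_⟩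
  · rintro (y | y)
    · refine (h y).trans (Nat.card_le_card_of_injective (fun a : {a // v a = y} =>
        (⟨Sum.inl a.1, congrArg Sum.inl a.2⟩ :
          {a : A.carrier ⊕ A'.carrier // sumMap v v' a = Sum.inl y})) ?_)
      intro a a' e
      exact Subtype.ext (Sum.inl_injective (congrArg Subtype.val e))
    · refine (h' y).trans (Nat.card_le_card_of_injective (fun a : {a // v' a = y} =>
        (⟨Sum.inr a.1, congrArg Sum.inr a.2⟩ :
          {a : A.carrier ⊕ A'.carrier // sumMap v v' a = Sum.inr y})) ?_)
      intro a a' e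
      exact Subtype.ext (Sum.inr_injective (congrArg Subtype.val e))
  · have : T.res (desc w w') x = T.pair (T.res w x) (T.res w' x) := by
      apply T.sum_ext
      · rw [T.res_inl_pair, ← T.res_comp]; rfl
      · rw [T.res_inr_pair, ← T.res_comp]; rfl
    have h₁ : T.nm (sumMap v v') (T.pair (T.res w x) (T.res w' x)) =
        T.pair (T.nm v (T.res w x)) (T.nm v' (T.res w' x)) :=
      T.multiplicative.tr_sumMap_pair v v' _ _
    rw [this, h₁]
    apply T.sum_ext
    · rw [T.res_inl_pair, T.res_mul, T.res_inl_pair, T.res_inl_pair]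
    · rw [T.res_inr_pair, T.res_mul, T.res_inr_pair, T.res_inr_pair]

end IsNormMultiple

/-- The ideal of `T(Y)` of all `T_u b` with `b` a norm multiple of `x` of weight `m`. -/
noncomputable def normIdeal {Z : FinGSet G} (x : T.obj Z) (m : ℕ) (Y : FinGSet G) :
    Ideal (T.obj Y) where
  carrier := {a | ∃ (B : FinGSet G) (f : B →[G] Y) (b : T.obj B),
    IsNormMultiple x m b ∧ a = T.tr f b}
  zero_mem' := ⟨empty G, fromEmpty Y, T.pt,
    ⟨empty G, MulActionHom.id G, fromEmpty Z, T.pt, fun y => y.elim, (T.eq_pt _).symm⟩, rfl⟩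
  add_mem' := by
    rintro _ _ ⟨B, f, b, hb, rfl⟩ ⟨B', f', b', hb', rfl⟩
    exact ⟨_, desc f f', T.pair b b', hb.pair hb', (T.tr_desc_pair f f' b b').symm⟩
  smul_mem' := by
    rintro a _ ⟨B, f, b, hb, rfl⟩
    exact ⟨B, f, T.res f a * b, hb.smul _, T.mul_tr f a b⟩

section NormIdeal

variable {Z : FinGSet G} {x : T.obj Z} {m n : ℕ} {X Y : FinGSet G}

theorem res_mem_normIdeal (f : X →[G] Y) {a : T.obj Y} (ha : a ∈ normIdeal x m Y) :
    T.res f a ∈ normIdeal x m X := by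
  obtain ⟨B, g, b, hb, rfl⟩ := ha
  exact ⟨_, _, _, hb.res _, T.res_tr _ _ _ _ (isPullback_pullback f g) b⟩

theorem tr_mem_normIdeal (f : X →[G] Y) {a : T.obj X} (ha : a ∈ normIdeal x m X) :
    T.tr f a ∈ normIdeal x m Y := by
  obtain ⟨B, g, b, hb, rfl⟩ := ha
  exact ⟨B, f.comp g, b, hb, (T.tr_comp f g b).symm⟩

/-- The exponential formula moves the norm inside the transfer; the new norm is along a pullback of
`f`, hence again along a surjection. -/
theorem nm_mem_normIdeal (f : X →[G] Y) (hf : Function.Surjective f) {a : T.obj X}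
    (ha : a ∈ normIdeal x m X) : T.nm f a ∈ normIdeal x m Y := by
  obtain ⟨B, g, b, hb, rfl⟩ := ha
  have hE := isExponential_depProd g f
  refine ⟨_, _, _, (hb.res _).nm _ fun p => ?_, T.nm_tr _ _ _ _ _ _ hE b⟩
  obtain ⟨y, hy⟩ := hf (depProdMap g f p)
  obtain ⟨e, ⟨-, he⟩, -⟩ := hE.isPullback.existsUnique _ _ hy
  exact ⟨e, he⟩

/-- Frobenius reciprocity, used twice with base change, turns a product of transfers into a transfer
from the fibre product. -/
theorem normIdeal_mul_le : normIdeal x m Y * normIdeal x n Y ≤ normIdeal x (m + n) Y := by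
  rw [Ideal.mul_le]
  rintro _ ⟨B, f, b, hb, rfl⟩ _ ⟨B', f', b', hb', rfl⟩
  rw [T.mul_tr, mul_comm, T.res_tr _ _ _ _ (isPullback_pullback f' f), T.mul_tr, ← T.tr_comp]
  refine ⟨_, _, _, ?_, rfl⟩
  rw [mul_comm]
  exact (hb.res _).mul (hb'.res _)

theorem mem_normIdeal_one_self (x : T.obj Z) : x ∈ normIdeal x 1 Z := by
  refine ⟨Z, MulActionHom.id G, x,
    ⟨Z, MulActionHom.id G, MulActionHom.id G, 1, fun y => ?_, ?_⟩, (T.tr_id Z x).symm⟩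
  · have : Nonempty {a : Z // (MulActionHom.id G : Z →[G] Z) a = y} := ⟨⟨y, rfl⟩⟩
    exact Nat.card_pos
  · rw [T.res_id, T.nm_id, one_mul]

theorem normIdeal_zero : normIdeal x 0 Y = ⊤ := by
  rw [Ideal.eq_top_iff_one]
  refine ⟨Y, MulActionHom.id G, 1,
    -- Weight `0` permits `A = ∅`, whose norm is `1`.
    ⟨empty G, fromEmpty Y, fromEmpty Z, 1, fun y => Nat.zero_le _, ?_⟩, (T.tr_id Y 1).symm⟩
  rw [T.eq_pt (T.res _ x), one_mul]
  rfl

end NormIdeal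

variable [Finite G]

/-! ### The pigeonhole argument and the comparison of radicals -/

section Nilpotence

variable {H L Q : Subgroup G}

/-- The points of `A` with stabilizer `Q` and with prescribed images in two `G`-sets. -/
def pointsOfType {A Y Z : FinGSet G} (v : A →[G] Y) (w : A →[G] Z) (Q : Subgroup G) (y : Y)
    (z : Z) : Set A :=
  {a | MulAction.stabilizer G a = Q ∧ v a = y ∧ w a = z}

/-- The orbit of each point of the given type contributes a factor `N_p R_q x`. Removing it loses at
most `|G|` points of that type, whence the bound `n|G|`. -/
theorem pow_dvd_nm_res {Y Z : FinGSet G} (x : T.obj Z) (p : orbit Q →[G] Y) (q : orbit Q →[G] Z)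
    (n : ℕ) {A : FinGSet G} (v : A →[G] Y) (w : A →[G] Z)
    (h : n * Nat.card G ≤
      (pointsOfType v w Q (p (basePoint Q)) (q (basePoint Q))).ncard) :
    T.nm p (T.res q x) ^ n ∣ T.nm v (T.res w x) := by
  induction n generalizing A with
  | zero => exact pow_zero (T.nm p (T.res q x)) ▸ one_dvd _
  | succ n ih =>
    have hpos : 0 < (pointsOfType v w Q (p (basePoint Q)) (q (basePoint Q))).ncard :=
      lt_of_lt_of_le (Nat.mul_pos n.succ_pos Nat.card_pos) h
    obtain ⟨a, ha, hav, haw⟩ := Set.nonempty_of_ncard_ne_zero hpos.ne'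
    have hp : v.comp (orbitLift a ha.ge) = p := orbit_hom_ext
      ((congrArg v (orbitLift_basePoint a ha.ge)).trans hav)
    have hq : w.comp (orbitLift a ha.ge) = q := orbit_hom_ext
      ((congrArg w (orbitLift_basePoint a ha.ge)).trans haw)
    rw [T.nm_eq_mul_of_bijective _ _ (bijective_desc_orbitLift a ha.symm), ← T.res_comp,
      ← T.res_comp, hp, hq, _root_.pow_succ']
    refine mul_dvd_mul_left _ (ih _ _ ?_)
    have hsub : pointsOfType v w Q (p (basePoint Q)) (q (basePoint Q)) ⊆
        MulAction.orbit G a ∪ orbitComplIncl a '' (pointsOfType (v.comp (orbitComplIncl a))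
          (w.comp (orbitComplIncl a)) Q (p (basePoint Q)) (q (basePoint Q))) := by
      rintro b ⟨hb, hbv, hbw⟩
      by_cases hba : b ∈ MulAction.orbit G a
      · exact Or.inl hba
      · refine Or.inr ⟨⟨b, hba⟩, ⟨?_, hbv, hbw⟩, rfl⟩
        rw [← hb]
        ext g
        exact Subtype.ext_iff
    have h₁ := (Set.ncard_le_ncard hsub (Set.toFinite _)).trans (Set.ncard_union_le _ _)
    have h₂ : (MulAction.orbit G a).ncard ≤ Nat.card G := by
      rw [← Nat.card_coe_set_eq]
      exact Nat.card_le_card_of_surjective _ Set.rangeFactorization_surjective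
    have h₃ := Set.ncard_image_le (f := orbitComplIncl a)
      (Set.toFinite (pointsOfType (v.comp (orbitComplIncl a))
          (w.comp (orbitComplIncl a)) Q (p (basePoint Q)) (q (basePoint Q))))
    rw [add_mul, one_mul] at h
    omega

theorem card_orbit_le (H : Subgroup G) : Nat.card (orbit H) ≤ Nat.card G :=
  Nat.card_le_card_of_surjective (QuotientGroup.mk : G → G ⧸ H) Quotient.mk_surjective

/-- If `v : A → G/L` has enough points in its source, many of them have the same type. -/
theorem exists_le_ncard_pointsOfType (n : ℕ) {A : FinGSet G} (v : A →[G] orbit L)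
    (w : A →[G] orbit H)
    (h : Nat.card (Subgroup G) * (Nat.card G * Nat.card G) * n < Nat.card A) :
    ∃ a : A, n < (pointsOfType v w (MulAction.stabilizer G a) (v a) (w a)).ncard := by
  classical
  have := Fintype.ofFinite A
  have := Fintype.ofFinite (Subgroup G × orbit L × orbit H)
  -- Bounding both orbits by `|G|` makes the estimate independent of `L` and `H`.
  have hc : Fintype.card (Subgroup G × orbit L × orbit H) * n < Fintype.card A := by
    rw [← Nat.card_eq_fintype_card, ← Nat.card_eq_fintype_card, Nat.card_prod, Nat.card_prod]
    refine lt_of_le_of_lt ?_ h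
    gcongr <;> exact card_orbit_le _
  obtain ⟨⟨Q, y, z⟩, hy⟩ := Fintype.exists_lt_card_fiber_of_mul_lt_card
    (fun a : A => ((MulAction.stabilizer G a, v a, w a) : Subgroup G × orbit L × orbit H)) hc
  have hne := Finset.card_pos.1 (lt_of_le_of_lt (Nat.zero_le _) hy)
  obtain ⟨a, ha⟩ := hne
  have ha' := (Finset.mem_filter.1 ha).2
  cases ha'
  refine ⟨a, lt_of_lt_of_le hy (le_of_eq ?_)⟩
  rw [← Set.ncard_coe_finset]
  congr 1
  ext b
  simp [pointsOfType]

namespace TambaraIdeal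

theorem nm_res_mem_of_pow_mem (I : T.TambaraIdeal) {x : T.level H} {n : ℕ}
    (hx : x ^ n ∈ I.level H) {A : FinGSet G} (v : A →[G] orbit L) (w : A →[G] orbit H)
    (h : Nat.card (Subgroup G) * (Nat.card G * Nat.card G) * (n * Nat.card G) < Nat.card A) :
    T.nm v (T.res w x) ∈ I.level L := by
  obtain ⟨a, ha⟩ := exists_le_ncard_pointsOfType _ v w h
  let i : orbit (MulAction.stabilizer G a) →[G] A := orbitLift a le_rfl
  have hi : i (basePoint _) = a := orbitLift_basePoint a le_rfl
  refine Ideal.mem_of_dvd _ (pow_dvd_nm_res x (v.comp i) (w.comp i) n v w ?_) ?_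
  · change _ ≤ (pointsOfType v w _ (v (i (basePoint _))) (w (i (basePoint _)))).ncard
    rw [hi]
    exact ha.le
  · rw [← T.nm_pow, ← T.res_pow]
    exact I.nm_hom_mem _ (I.res_hom_mem _ hx)

/-- The Tambara ideal formed by the ideals `normIdeal x m`. -/
noncomputable def ofNormIdeal {Z : FinGSet G} (x : T.obj Z) (m : ℕ) : T.TambaraIdeal :=
  ofHoms (fun H => normIdeal x m (orbit H)) (fun f _ => res_mem_normIdeal f)
    (fun f _ => tr_mem_normIdeal f) (fun {H _} f _ ha =>
      have : Nonempty (orbit H) := ⟨basePoint H⟩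
      nm_mem_normIdeal f (surjective_of_orbit f) ha)

theorem span_pow_le_ofNormIdeal (x : T.level H) (m : ℕ) : span x ^ m ≤ ofNormIdeal x m := by
  induction m with
  | zero => exact fun K a _ => (normIdeal_zero (x := x) (Y := orbit K)).ge trivial
  | succ m ih =>
    refine mul_le_iff.2 fun K => (Ideal.mul_mono (ih K) ?_).trans normIdeal_mul_le
    exact (span_le_iff (I := ofNormIdeal x 1)).2 (mem_normIdeal_one_self x) K

/-- Restricting to the orbits of the source of the transfer leaves norms to some `G/L`; the fibre
over the base point alone already has enough points for the pigeonhole. -/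
theorem ofNormIdeal_le (I : T.TambaraIdeal) {x : T.level H} {n m : ℕ}
    (hx : x ^ n ∈ I.level H)
    (h : Nat.card (Subgroup G) * (Nat.card G * Nat.card G) * (n * Nat.card G) < m) :
    ofNormIdeal x m ≤ I := by
  rintro K _ ⟨B, f, b, hb, rfl⟩
  refine T.tr_mem_of_forall _ _ _ fun L g => I.tr_hom_mem _ ?_
  obtain ⟨A, v, w, c, hA, hc⟩ := hb.res g
  rw [hc]
  refine Ideal.mul_mem_left _ _ (I.nm_res_mem_of_pow_mem hx v w (h.trans_le ?_))
  exact (hA (basePoint L)).trans (Finite.card_subtype_le _)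

theorem mem_nakaokaRadical_iff {I : T.TambaraIdeal} {x : T.level H} :
    x ∈ I.nakaokaRadical H ↔ x ∈ (I.level H).radical := by
  constructor
  · rintro ⟨n, hn⟩
    exact ⟨n, hn H (pow_mem_pow (mem_span_self x) n)⟩
  · rintro ⟨n, hn⟩
    exact ⟨_, (span_pow_le_ofNormIdeal x _).trans (I.ofNormIdeal_le hn (Nat.lt_succ_self _))⟩

/-- Primality speaks only of ideals, so `xⁿ ∈ P` must first be upgraded to `⟨x⟩ᵐ ≤ P`; this is the
comparison of radicals applied to `P`. -/
theorem IsPrime.mem_of_pow_mem {P : T.TambaraIdeal} (hP : P.IsPrime) {x : T.level H} {n : ℕ}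
    (hx : x ^ n ∈ P.level H) : x ∈ P.level H := by
  obtain ⟨m, hm⟩ := mem_nakaokaRadical_iff.2 ⟨n, hx⟩
  exact span_le_iff.1 (hP.le_of_pow_le hm)

theorem mem_sInf_isPrime_iff {I : T.TambaraIdeal} {x : T.level H} :
    x ∈ (sInf {P : T.TambaraIdeal | P.IsPrime ∧ I ≤ P}).level H ↔ x ∈ (I.level H).radical := by
  rw [mem_sInf]
  constructor
  · intro h
    by_contra hx
    obtain ⟨P, hP, hIP, hxP⟩ := exists_isPrime_of_forall_pow_notMem
      (I := I) (x := x) fun n hn => hx ⟨n, hn⟩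
    exact hxP (h P ⟨hP, hIP⟩)
  · rintro ⟨n, hn⟩ P ⟨hP, hIP⟩
    exact hP.mem_of_pow_mem (hIP H hn)

end TambaraIdeal

end Nilpotence

end TambaraFunctor

theorem mainTheorem5 {G : Type u} [Group G] [Finite G] (T : TambaraFunctor.{u, v} G)
    (I : T.TambaraIdeal) :
    (∀ H : Subgroup G, I.nakaokaRadical H = ((I.level H).radical : Set (T.level H))) ∧
    ∃ R : T.TambaraIdeal,
      (∀ H : Subgroup G, (R.level H : Set (T.level H)) = I.nakaokaRadical H) ∧
      R = sInf {P : T.TambaraIdeal | P.IsPrime ∧ I ≤ P} := by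
  -- The witness is the intersection of primes, a Tambara ideal by construction, so closure of the
  -- radical needs no separate check.
  refine ⟨fun H => Set.ext fun x => TambaraFunctor.TambaraIdeal.mem_nakaokaRadical_iff, _,
    fun H => Set.ext fun x => ?_, rfl⟩
  exact TambaraFunctor.TambaraIdeal.mem_sInf_isPrime_iff.trans
    TambaraFunctor.TambaraIdeal.mem_nakaokaRadical_iff.symm
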